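/- There is an absolute constant $C_0 > 0$ such that the following holds. Let $\mathbb{F}_q$ be a finite field, let $k, n, L$ be integers with $k, n \ge 0$ and $1 \le L \le q^k$, and let $G \in \mathbb{F}_q^{k\times n}$ be a random matrix whose columns are independent random vectors (with arbitrary, possibly different, distributions). For a message $x \in \mathbb{F}_q^k$ let $c(x) = x^T G \in \mathbb{F}_q^n$ be its encoding, let $\mathcal{C} = \{c(x) : x \in \mathbb{F}_q^k\}$ be the resulting random linear code, and let $N$ be a positive integer such that $|\mathcal{C}| \le N$ almost surely (for example $N = |\mathcal{C}|$ if the size of $\mathcal{C}$ is almost surely constant, and $N = q^k$ always). For $u, v \in \mathbb{F}_q^n$ let $\mathrm{agr}(u,v) = |\{j : u_j = v_j\}|$. Let \[ \mathcal{E} = \max_{\Lambda \subseteq \mathbb{F}_q^k,\ |\Lambda| = L} \ \mathbb{E}_{G} \max_{z \in \mathbb{F}_q^n} \sum_{x \in \Lambda} \mathrm{agr}(c(x), z), \qquad Y = C_0\, L \,\log_2(N)\, (\log_2 L)^5 . \] Then \[ \mathbb{E}_{G} \max_{z \in \mathbb{F}_q^n} \ \max_{\Lambda \subseteq \mathbb{F}_q^k,\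 |\Lambda| = L} \ \sum_{x \in \Lambda} \mathrm{agr}(c(x), z) \le \mathcal{E} + Y + \sqrt{\mathcal{E}\, Y}. \] -/

import Mathlib

open MeasureTheory ProbabilityTheory

namespace RandomLinearCode

/-- The encoding `c(x) = xᵀ G` of the message `x` under the generator matrix `G`. -/
def encode {F : Type*} [Field F] {k n : ℕ} (G : Matrix (Fin k) (Fin n) F)
    (x : Fin k → F) : Fin n → F :=
  Matrix.vecMul x G

/-- The linear code generated by `G`, the set of all encodings of messages. -/
def code {F : Type*} [Field F] {k n : ℕ} (G : Matrix (Fin k) (Fin n) F) : Set (Fin n → F) :=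
  Set.range (encode G)

/-- `agr u v` is the number of coordinates in which `u` and `v` agree. -/
def agr {F : Type*} [DecidableEq F] {n : ℕ} (u v : Fin n → F) : ℕ :=
  (Finset.univ.filter fun j => u j = v j).card

/-- The total agreement of the encodings of the messages in `Λ` with the word `z`. -/
def totalAgr {F : Type*} [Field F] [DecidableEq F] {k n : ℕ} (G : Matrix (Fin k) (Fin n) F)
    (Λ : Finset (Fin k → F)) (z : Fin n → F) : ℝ :=
  ∑ x ∈ Λ, (agr (encode G x) z : ℝ)

/-- A random generator matrix has independent symbols if its columns are independent
random vectors (not necessarily identically distributed). -/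
def IndependentSymbols {F : Type*} [MeasurableSpace F] {k n : ℕ} {Ω : Type*}
    [MeasurableSpace Ω] (μ : Measure Ω) (G : Ω → Matrix (Fin k) (Fin n) F) : Prop :=
  iIndepFun (fun (j : Fin n) (ω : Ω) => (fun i : Fin k => G ω i j)) μ

/-- The maximum over message sets `Λ` of size `L` of the expected maximum over `z` of the
total agreement. All maxima are suprema of real numbers over finite sets. -/
noncomputable def maxExpAgr {F : Type*} [Field F] [DecidableEq F] {k n : ℕ} {Ω : Type*}
    [MeasurableSpace Ω] (μ : Measure Ω) (G : Ω → Matrix (Fin k) (Fin n) F) (L : ℕ) : ℝ :=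
  ⨆ Λ : {Λ : Finset (Fin k → F) // Λ.card = L},
    ∫ ω, (⨆ z : Fin n → F, totalAgr (G ω) Λ.1 z) ∂μ

/-- The expected maximum, over words `z` and message sets `Λ` of size `L`, of the total
agreement. -/
noncomputable def expMaxAgr {F : Type*} [Field F] [DecidableEq F] {k n : ℕ} {Ω : Type*}
    [MeasurableSpace Ω] (μ : Measure Ω) (G : Ω → Matrix (Fin k) (Fin n) F) (L : ℕ) : ℝ :=
  ∫ ω, (⨆ z : Fin n → F, ⨆ Λ : {Λ : Finset (Fin k → F) // Λ.card = L},
    totalAgr (G ω) Λ.1 z) ∂μ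

/-- `Y = C₀ L log N log⁵ L`, with logarithms to base two. -/
noncomputable def errorTerm (C₀ : ℝ) (L N : ℕ) : ℝ :=
  C₀ * L * Real.logb 2 N * Real.logb 2 L ^ 5

end RandomLinearCode

/-! Maximizing over `z` coordinate by coordinate turns the total agreement of `Λ` into a sum over
columns of pluralities, i.e. a sum of independent contributions. Symmetrization
(`prodExpect_iSup_le`) bounds the expected maximum over `Λ` by the maximal expectation plus twice a
Rademacher supremum. With `G` fixed and `Q` the maximal total plurality, that supremum is at most
`√(Y * Q) / 2` (`expect_signedSup_colPlur_le`). Jensen then gives `q ≤ E + √(Y * q)` for `q` the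
expectation of `Q`, and solving this quadratic inequality gives the claim.

A union bound over all lists of `2 ^ m` codewords is too costly where pluralities are large, so the
Rademacher process is chained. Keeping one word of each pair roughly halves every plurality: for a
fixed symbol the error is a Rademacher sum whose variance is at most its multiplicity. A list of `2
^ r` words is one of only `|W| ^ 2 ^ r`, so shorter lists need cheaper union bounds. A good halving
exists by averaging, and repeating this leads down to single words.

Pluralities are cut at `M = 8 * m ^ 3`. The part below `M` has sum of squares at most `M * Q` and
needs only one union bound. Above `M` the relative halving error is at most `1 / m` on average, so
`m` halvings inflate the total by at most `(1 + 1 / m) ^ m ≤ 3`. -/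

open scoped BigOperators

namespace RandomLinearCode

/-! ### Rademacher sums -/

section Rademacher

variable {ι κ : Type*} [Fintype ι]

/-- The sign attached to a bit. -/
def sgn (b : Bool) : ℝ := cond b 1 (-1)

/-- The signed sum of the vector `a` with the signs `η`. -/
def signedSum (η : ι → Bool) (a : ι → ℝ) : ℝ := ∑ i, sgn (η i) * a i

lemma signedSum_add (η : ι → Bool) (a b : ι → ℝ) :
    signedSum η (fun i => a i + b i) = signedSum η a + signedSum η b := by
  simp [signedSum, mul_add, Finset.sum_add_distrib]

lemma signedSum_smul (η : ι → Bool) (c : ℝ) (a : ι → ℝ) :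
    signedSum η (fun i => c * a i) = c * signedSum η a := by
  simp only [signedSum, Finset.mul_sum]
  exact Finset.sum_congr rfl fun i _ => by ring

lemma sum_bool_fun_prod [DecidableEq ι] (f : ι → Bool → ℝ) :
    ∑ η : ι → Bool, ∏ i, f i (η i) = ∏ i, ∑ b, f i b := by
  rw [Finset.prod_univ_sum, Fintype.piFinset_univ]

lemma expect_exp_signedSum_le [DecidableEq ι] (a : ι → ℝ) :
    𝔼 η : ι → Bool, Real.exp (signedSum η a) ≤ Real.exp ((∑ i, a i ^ 2) / 2) := by
  have h : 𝔼 η : ι → Bool, Real.exp (signedSum η a) = ∏ i, Real.cosh (a i) := by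
    rw [Fintype.expect_eq_sum_div_card]
    simp only [signedSum, Real.exp_sum]
    rw [sum_bool_fun_prod (fun i b => Real.exp (sgn b * a i))]
    simp only [Fintype.sum_bool, sgn, cond_true, cond_false, one_mul, neg_mul, Fintype.card_fun,
      Fintype.card_bool, Nat.cast_pow, Nat.cast_ofNat, Real.cosh_eq]
    rw [Finset.prod_div_distrib]
    simp
  rw [h, Finset.sum_div, Real.exp_sum]
  exact Finset.prod_le_prod (fun i _ => (Real.cosh_pos _).le)
    fun i _ => Real.cosh_le_exp_half_sq _

lemma integrable_exp_quadratic (c : ℝ) :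
    Integrable fun t : ℝ => Real.exp (-(1 / 2) * (t - c) ^ 2) :=
  (integrable_exp_neg_mul_sq (by norm_num : (0 : ℝ) < 1 / 2)).comp_sub_right c

lemma exp_sq_div_four_mul (z t : ℝ) :
    Real.exp (z ^ 2 / 4) * Real.exp (-(1 / 2) * (t - z / √2) ^ 2) =
      Real.exp (-(1 / 2) * t ^ 2) * Real.exp (t / √2 * z) := by
  rw [← Real.exp_add, ← Real.exp_add]
  congr 1
  have h : (√2) ^ 2 = 2 := Real.sq_sqrt (by norm_num)
  field_simp
  linear_combination (2 * z ^ 2 : ℝ) * h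

/-- Gaussian linearization: `exp (z ^ 2 / 4)` is the mean of `exp (t * z / √2)` over a standard
Gaussian `t`. Averaging over the signs first leaves at most the mean of `exp (t ^ 2 / 4)`, which is
`√2`. -/
lemma expect_exp_sq_le_two [DecidableEq ι] (a : ι → ℝ) (ha : ∑ i, a i ^ 2 ≤ 1) :
    𝔼 η : ι → Bool, Real.exp (signedSum η a ^ 2 / 4) ≤ 2 := by
  have hπ := Real.pi_pos
  have key : (𝔼 η : ι → Bool, Real.exp (signedSum η a ^ 2 / 4)) * √(Real.pi / (1 / 2)) ≤
      √(Real.pi / (1 / 4)) := by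
    have h1 : ∀ z : ℝ, Real.exp (z ^ 2 / 4) * √(Real.pi / (1 / 2)) =
        ∫ t : ℝ, Real.exp (z ^ 2 / 4) * Real.exp (-(1 / 2) * (t - z / √2) ^ 2) := by
      intro z
      rw [integral_const_mul, integral_sub_right_eq_self
        (fun t : ℝ => Real.exp (-(1 / 2) * t ^ 2)) (z / √2), integral_gaussian]
    rw [Finset.expect_mul]
    simp only [h1]
    rw [Fintype.expect_eq_sum_div_card, ← integral_finsetSum _
      (fun η _ => (integrable_exp_quadratic _).const_mul _), ← integral_div,
      ← integral_gaussian]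
    refine integral_mono ((integrable_finsetSum _
      (fun η _ => (integrable_exp_quadratic _).const_mul _)).div_const _)
      (integrable_exp_neg_mul_sq (by norm_num)) fun t => ?_
    dsimp only
    rw [← Fintype.expect_eq_sum_div_card]
    simp only [exp_sq_div_four_mul, ← signedSum_smul]
    rw [← Finset.mul_expect]
    calc _ ≤ Real.exp (-(1 / 2) * t ^ 2) *
          Real.exp ((∑ i, (t / √2 * a i) ^ 2) / 2) := by
          gcongr
          exact expect_exp_signedSum_le _
      _ ≤ _ := by
          rw [← Real.exp_add]
          apply Real.exp_le_exp.2
          simp only [mul_pow, ← Finset.mul_sum, div_pow]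
          rw [Real.sq_sqrt (by norm_num : (0 : ℝ) ≤ 2)]
          nlinarith [mul_le_mul_of_nonneg_left ha (sq_nonneg t)]
  have h2 : √(Real.pi / (1 / 4)) ≤ 2 * √(Real.pi / (1 / 2)) := by
    rw [Real.sqrt_le_left (by positivity), mul_pow, Real.sq_sqrt (by positivity)]
    ring_nf
    linarith
  exact le_of_mul_le_mul_right (key.trans h2) (by positivity)

lemma expect_le_log_of_exp_le {α : Type*} [Fintype α] [Nonempty α] (X : α → ℝ) {B : ℝ}
    (h : 𝔼 x, Real.exp (X x) ≤ B) : 𝔼 x, X x ≤ Real.log B := by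
  set m := 𝔼 x, X x with hm
  have h1 : (1 : ℝ) ≤ 𝔼 x, Real.exp (X x - m) := by
    calc (1 : ℝ) = 𝔼 x, (X x - m + 1) := by
          rw [Finset.expect_add_distrib, Finset.expect_sub_distrib, ← hm]
          simp
      _ ≤ _ := Finset.expect_le_expect fun x _ => Real.add_one_le_exp _
  simp only [Real.exp_sub] at h1
  rw [← Finset.expect_div, le_div_iff₀ (Real.exp_pos _), one_mul] at h1
  have hB : Real.exp m ≤ B := h1.trans h
  rwa [Real.le_log_iff_exp_le ((Real.exp_pos m).trans_le hB)]

/-- A maximal inequality for squares of Rademacher sums. -/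
lemma expect_le_log_card [DecidableEq ι] (s : Finset κ) (a : κ → ι → ℝ)
    {σ : ℝ} (hσ : 0 < σ) (ha : ∀ k ∈ s, ∑ i, a k i ^ 2 ≤ σ) (X : (ι → Bool) → ℝ)
    (hX : ∀ η, ∃ k ∈ s, X η ≤ signedSum η (a k) ^ 2) :
    𝔼 η, X η ≤ 4 * σ * Real.log (2 * s.card) := by
  have h1 : 𝔼 η, X η / (4 * σ) ≤ Real.log (2 * s.card) := by
    apply expect_le_log_of_exp_le
    have hb : ∀ k ∈ s, 𝔼 η : ι → Bool, Real.exp (signedSum η (a k) ^ 2 / (4 * σ)) ≤ 2 := by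
      intro k hk
      have := expect_exp_sq_le_two (fun i => (√σ)⁻¹ * a k i) (by
        simp only [mul_pow, ← Finset.mul_sum, inv_pow, Real.sq_sqrt hσ.le]
        rw [inv_mul_le_iff₀ hσ, mul_one]
        exact ha k hk)
      simp only [signedSum_smul, mul_pow, inv_pow, Real.sq_sqrt hσ.le] at this
      have e : ∀ z : ℝ, z / (4 * σ) = σ⁻¹ * z / 4 := fun z => by field_simp
      simpa only [e] using this
    calc 𝔼 η, Real.exp (X η / (4 * σ))
        ≤ 𝔼 η, ∑ k ∈ s, Real.exp (signedSum η (a k) ^ 2 / (4 * σ)) := by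
          refine Finset.expect_le_expect fun η _ => ?_
          obtain ⟨k, hk, hle⟩ := hX η
          refine le_trans ?_ (Finset.single_le_sum (f := fun k =>
            Real.exp (signedSum η (a k) ^ 2 / (4 * σ))) (fun _ _ => (Real.exp_pos _).le) hk)
          apply Real.exp_le_exp.2
          gcongr
      _ = ∑ k ∈ s, 𝔼 η : ι → Bool, Real.exp (signedSum η (a k) ^ 2 / (4 * σ)) :=
          Finset.expect_sum_comm _ _ _
      _ ≤ ∑ k ∈ s, (2 : ℝ) := Finset.sum_le_sum hb
      _ = 2 * s.card := by simp [mul_comm]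
  rw [← Finset.expect_div, div_le_iff₀ (by positivity)] at h1
  linarith

/-- The largest normalized squared signed sum over a family of vectors. -/
noncomputable def maxSq (v : κ → ι → ℝ) (η : ι → Bool) : ℝ :=
  ⨆ k, signedSum η (v k) ^ 2 / ∑ i, v k i ^ 2

lemma maxSq_nonneg (v : κ → ι → ℝ) (η : ι → Bool) : 0 ≤ maxSq v η :=
  Real.iSup_nonneg fun _ => by positivity

lemma signedSum_le_sqrt_maxSq [Finite κ] (v : κ → ι → ℝ) (η : ι → Bool) (k : κ) :
    signedSum η (v k) ≤ √(maxSq v η * ∑ i, v k i ^ 2) := by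
  apply Real.le_sqrt_of_sq_le
  -- For the zero vector the quotient in `maxSq` is `0 / 0 = 0`, so this case is separate.
  rcases (Finset.sum_nonneg fun i _ => sq_nonneg (v k i) :
    0 ≤ ∑ i, v k i ^ 2).eq_or_lt with h | h
  · have h0 : ∀ i, v k i = 0 := fun i => by
      have := (Finset.sum_eq_zero_iff_of_nonneg fun i _ => sq_nonneg (v k i)).1 h.symm i
        (Finset.mem_univ i)
      exact pow_eq_zero_iff (two_ne_zero) |>.1 this
    simp [signedSum, h0]
  · rw [← div_le_iff₀ h]
    exact le_ciSup (f := fun k => signedSum η (v k) ^ 2 / ∑ i, v k i ^ 2)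
      (Set.finite_range _).bddAbove k

lemma expect_maxSq_le [DecidableEq ι] [Fintype κ] [Nonempty κ] (v : κ → ι → ℝ) :
    𝔼 η, maxSq v η ≤ 4 * Real.log (2 * Fintype.card κ) := by
  have := expect_le_log_card (Finset.univ : Finset κ)
    (fun k i => (√(∑ i, v k i ^ 2))⁻¹ * v k i) one_pos (fun k _ => by
      simp only [mul_pow, ← Finset.mul_sum, inv_pow]
      rw [Real.sq_sqrt (Finset.sum_nonneg fun i _ => sq_nonneg _)]
      exact inv_mul_le_one) (maxSq v) (fun η => by
      obtain ⟨k, hk⟩ := exists_eq_ciSup_of_finite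
        (f := fun k => signedSum η (v k) ^ 2 / ∑ i, v k i ^ 2)
      refine ⟨k, Finset.mem_univ k, ?_⟩
      rw [maxSq, ← hk, signedSum_smul, mul_pow, inv_pow,
        Real.sq_sqrt (Finset.sum_nonneg fun i _ => sq_nonneg _), div_eq_inv_mul])
  simpa using this

lemma expect_sqrt_le {α : Type*} [Fintype α] [Nonempty α] (X : α → ℝ) (hX : ∀ x, 0 ≤ X x) :
    𝔼 x, √(X x) ≤ √(𝔼 x, X x) := by
  apply Real.le_sqrt_of_sq_le
  have := Finset.expect_mul_sq_le_sq_mul_sq Finset.univ (fun x => √(X x)) (fun _ => (1 : ℝ))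
  simpa [Real.sq_sqrt (hX _)] using this

end Rademacher

/-! ### Pluralities and random halving -/

section Plurality

variable {ι W F : Type*} [Fintype ι] [DecidableEq F]

/-- The number of occurrences of the symbol `α` in the list `ℓ`, where `none` is no symbol. -/
def mult (ℓ : ι → Option F) (α : F) : ℕ := (Finset.univ.filter fun i => ℓ i = some α).card

/-- The largest number of occurrences of a symbol in the list `ℓ`. -/
def plur [Fintype F] (ℓ : ι → Option F) : ℕ := Finset.univ.sup (mult ℓ)

/-- The sublist that picks one entry out of each pair. -/
def half (ℓ : ι × Bool → W) (ε : ι → Bool) (i : ι) : W := ℓ (i, ε i)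

lemma mult_le_plur [Fintype F] (ℓ : ι → Option F) (α : F) : mult ℓ α ≤ plur ℓ :=
  Finset.le_sup (f := mult ℓ) (Finset.mem_univ α)

lemma exists_mult_eq_plur [Fintype F] (ℓ : ι → Option F) (h : 0 < plur ℓ) : ∃ α, mult ℓ α = plur ℓ := by
  obtain ⟨α, -, -⟩ := Finset.lt_sup_iff.1 h
  obtain ⟨β, -, hβ⟩ := Finset.exists_mem_eq_sup Finset.univ ⟨α, Finset.mem_univ α⟩ (mult ℓ)
  exact ⟨β, hβ.symm⟩

lemma cast_mult (ℓ : ι → Option F) (α : F) :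
    (mult ℓ α : ℝ) = ∑ i, if ℓ i = some α then 1 else 0 := by
  simp [mult]

/-- Within a pair, the sum of both indicators minus twice the selected one is plus or minus their
difference. -/
lemma mult_sub_two_mul_mult_half (ℓ : ι × Bool → Option F) (α : F) (ε : ι → Bool) :
    (mult ℓ α : ℝ) - 2 * mult (half ℓ ε) α = signedSum ε fun i =>
      (if ℓ (i, false) = some α then 1 else 0) - (if ℓ (i, true) = some α then 1 else 0) := by
  rw [cast_mult, cast_mult, Fintype.sum_prod_type, Finset.mul_sum, ← Finset.sum_sub_distrib]
  refine Finset.sum_congr rfl fun i _ => ?_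
  cases h : ε i <;> simp only [Fintype.sum_bool, half, sgn, h, cond_true, cond_false] <;> ring

lemma sum_sq_le_mult (ℓ : ι × Bool → Option F) (α : F) :
    ∑ i, (((if ℓ (i, false) = some α then 1 else 0) -
      (if ℓ (i, true) = some α then 1 else 0) : ℝ)) ^ 2 ≤ mult ℓ α := by
  rw [cast_mult, Fintype.sum_prod_type]
  refine Finset.sum_le_sum fun i _ => ?_
  simp only [Fintype.sum_bool]
  split_ifs <;> norm_num

lemma mult_half_le (ℓ : ι × Bool → Option F) (ε : ι → Bool) (α : F) :
    mult (half ℓ ε) α ≤ mult ℓ α := by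
  refine Finset.card_le_card_of_injOn (fun i => (i, ε i)) (fun i hi => ?_)
    (fun i _ j _ h => (Prod.ext_iff.1 h).1)
  exact Finset.mem_coe.2 (Finset.mem_filter.2 ⟨Finset.mem_univ _, (Finset.mem_filter.1 hi).2⟩)

lemma plur_half_le [Fintype F] (ℓ : ι × Bool → Option F) (ε : ι → Bool) : plur (half ℓ ε) ≤ plur ℓ :=
  Finset.sup_mono_fun fun α _ => mult_half_le ℓ ε α

/-- The witness is the most frequent symbol of whichever list dominates: `ℓ` if its plurality is at
least twice that of the half, otherwise the half. -/
lemma exists_sq_plur_sub_le [Fintype F] (ℓ : ι × Bool → Option F) (ε : ι → Bool) (h : 0 < plur ℓ) :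
    ∃ α, 0 < mult ℓ α ∧ ((plur ℓ : ℝ) - 2 * plur (half ℓ ε)) ^ 2 ≤
      ((mult ℓ α : ℝ) - 2 * mult (half ℓ ε) α) ^ 2 := by
  rcases le_total (2 * plur (half ℓ ε) : ℝ) (plur ℓ) with hle | hle
  · obtain ⟨α, hα⟩ := exists_mult_eq_plur ℓ h
    refine ⟨α, hα ▸ h, ?_⟩
    have : (mult (half ℓ ε) α : ℝ) ≤ plur (half ℓ ε) := by exact_mod_cast mult_le_plur _ _
    rw [hα]
    apply pow_le_pow_left₀ <;> linarith
  · have h' : 0 < plur (half ℓ ε) := by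
      rcases Nat.eq_zero_or_pos (plur (half ℓ ε)) with h0 | h0
      · rw [h0] at hle
        have : (0 : ℝ) < plur ℓ := by exact_mod_cast h
        simp at hle
        omega
      · exact h0
    obtain ⟨α, hα⟩ := exists_mult_eq_plur _ h'
    refine ⟨α, lt_of_lt_of_le (hα ▸ h') (mult_half_le ℓ ε α), ?_⟩
    have : (mult ℓ α : ℝ) ≤ plur ℓ := by exact_mod_cast mult_le_plur _ _
    rw [hα, ← neg_sq, ← neg_sq ((mult ℓ α : ℝ) - _)]
    apply pow_le_pow_left₀ <;> linarith

lemma expect_sq_plur_sub_le [Fintype F] [DecidableEq ι] (ℓ : ι × Bool → Option F) :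
    𝔼 ε, ((plur ℓ : ℝ) - 2 * plur (half ℓ ε)) ^ 2 ≤
      4 * plur ℓ * Real.log (4 * Fintype.card ι) := by
  rcases Nat.eq_zero_or_pos (plur ℓ) with h0 | h0
  · have : ∀ ε, plur (half ℓ ε) = 0 := fun ε => by
      have := plur_half_le ℓ ε
      omega
    simp [h0, this]
  -- Only symbols that occur on the list compete, so the logarithm depends on the list length and
  -- not on the size of the alphabet.
  · have hcard : (Finset.univ.filter fun α => 0 < mult ℓ α).card ≤ Fintype.card ι * 2 := by
      have h1 : (Finset.univ.filter fun α => 0 < mult ℓ α).card ≤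
          (Finset.univ.image ℓ).card := by
        refine Finset.card_le_card_of_injOn some (fun α hα => ?_)
          (Option.some_injective F).injOn
        obtain ⟨i, hi⟩ := Finset.card_pos.1 (Finset.mem_filter.1 hα).2
        exact Finset.mem_coe.2 (Finset.mem_image.2 ⟨i, Finset.mem_univ i, (Finset.mem_filter.1 hi).2⟩)
      refine h1.trans (Finset.card_image_le.trans ?_)
      simp
    obtain ⟨β, hβ⟩ := exists_mult_eq_plur ℓ h0
    have hpos : 0 < (Finset.univ.filter fun α => 0 < mult ℓ α).card :=
      Finset.card_pos.2 ⟨β, by simp [hβ, h0]⟩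
    refine (expect_le_log_card (Finset.univ.filter fun α => 0 < mult ℓ α) (fun α i =>
      (if ℓ (i, false) = some α then 1 else 0) - (if ℓ (i, true) = some α then 1 else 0))
      (σ := plur ℓ) (by exact_mod_cast h0)
      (fun α _ => (sum_sq_le_mult ℓ α).trans (by exact_mod_cast mult_le_plur _ _)) _
      (fun ε => ?_)).trans ?_
    · obtain ⟨α, hα, hle⟩ := exists_sq_plur_sub_le ℓ ε h0
      exact ⟨α, by simpa using hα, by rwa [← mult_sub_two_mul_mult_half]⟩
    · refine mul_le_mul_of_nonneg_left (Real.log_le_log ?_ ?_) (by positivity)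
      · have : (0 : ℝ) < (Finset.univ.filter fun α => 0 < mult ℓ α).card := by exact_mod_cast hpos
        positivity
      have : ((Finset.univ.filter fun α => 0 < mult ℓ α).card : ℝ) ≤ Fintype.card ι * 2 := by
        exact_mod_cast hcard
      linarith

end Plurality

/-! ### Truncated pluralities -/

section Truncation

/-- The part of `p` above the threshold `M`. -/
def trunc (M p : ℝ) : ℝ := max (p - M) 0

open Classical in
/-- The number `p` if it exceeds the threshold `M`, and zero otherwise. -/
noncomputable def heavy (M p : ℝ) : ℝ := if M < p then p else 0

lemma heavy_nonneg {M p : ℝ} (hp : 0 ≤ p) : 0 ≤ heavy M p := by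
  unfold heavy; split_ifs <;> simp [hp]

lemma heavy_le {M p : ℝ} (hp : 0 ≤ p) : heavy M p ≤ p := by
  unfold heavy; split_ifs <;> simp [hp]

variable {α : Type*} [Fintype α] [Nonempty α] {m M p : ℝ} {p' : α → ℝ}

/-- Truncation changes `p - 2 * p'` by at most `M`. For `p > M` both `16 * m * p` and `2 * M ^ 2`
are then at most `2 * M * p`; for `p ≤ M` everything vanishes. -/
lemma expect_sq_trunc_sub_le (hm : 1 ≤ m) (hM : M = 8 * m ^ 3)
    (hle : ∀ x, p' x ≤ p) (hvar : 𝔼 x, (p - 2 * p' x) ^ 2 ≤ 8 * m * p) :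
    𝔼 x, (trunc M p - 2 * trunc M (p' x)) ^ 2 ≤ 4 * M * heavy M p := by
  have hm3 : m ≤ m ^ 3 := le_self_pow₀ hm (by norm_num)
  unfold heavy
  split_ifs with h
  · have hpt : ∀ x, (trunc M p - 2 * trunc M (p' x)) ^ 2 ≤
        2 * (p - 2 * p' x) ^ 2 + 2 * M ^ 2 := by
      intro x
      have h1 : |trunc M p - 2 * trunc M (p' x)| ≤ |p - 2 * p' x| + M := by
        unfold trunc
        rw [max_eq_left (by linarith)]
        rcases max_cases (p' x - M) 0 with ⟨h2, h3⟩ | ⟨h2, h3⟩ <;> rw [h2]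
        · rw [show p - M - 2 * (p' x - M) = (p - 2 * p' x) + M by ring]
          refine (abs_add_le _ _).trans ?_
          rw [abs_of_nonneg (by linarith : (0 : ℝ) ≤ M)]
        · rw [abs_of_nonneg (by linarith)]
          have := le_abs_self (p - 2 * p' x)
          linarith
      have h2 := pow_le_pow_left₀ (abs_nonneg _) h1 2
      rw [sq_abs] at h2
      nlinarith [sq_nonneg (|p - 2 * p' x| - M), sq_abs (p - 2 * p' x)]
    refine (Finset.expect_le_expect fun x _ => hpt x).trans ?_
    rw [Finset.expect_add_distrib, ← Finset.mul_expect, Fintype.expect_const]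
    nlinarith
  · push Not at h
    have : ∀ x, trunc M (p' x) = 0 := fun x => max_eq_right (by linarith [hle x])
    have h' : trunc M p = 0 := max_eq_right (by linarith)
    simp [this, h']

lemma expect_heavy_le (hm : 1 ≤ m) (hM : M = 8 * m ^ 3) (h0 : ∀ x, 0 ≤ p' x)
    (hle : ∀ x, p' x ≤ p) (hvar : 𝔼 x, (p - 2 * p' x) ^ 2 ≤ 8 * m * p) :
    𝔼 x, 2 * heavy M (p' x) ≤ (1 + 1 / m) * heavy M p := by
  unfold heavy
  split_ifs with h
  · have hm3 : 0 < m ^ 3 := by positivity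
    have hp : 0 < p := by linarith
    have hdev : 𝔼 x, (2 * p' x - p) ≤ p / m := by
      refine abs_le_of_sq_le_sq' ?_ (by positivity) |>.2
      calc (𝔼 x, (2 * p' x - p)) ^ 2 ≤ 𝔼 x, (2 * p' x - p) ^ 2 := by
            have := Finset.expect_mul_sq_le_sq_mul_sq Finset.univ
              (fun x => 2 * p' x - p) (fun _ => (1 : ℝ))
            simpa using this
        _ = 𝔼 x, (p - 2 * p' x) ^ 2 := Finset.expect_congr rfl fun x _ => by ring
        _ ≤ 8 * m * p := hvar
        -- This fixes the threshold: the inequality amounts to `8 * m ^ 3 ≤ p`.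
        _ ≤ (p / m) ^ 2 := by
            rw [div_pow, le_div_iff₀ (by positivity)]
            nlinarith
    calc 𝔼 x, 2 * (if M < p' x then p' x else 0) ≤ 𝔼 x, ((2 * p' x - p) + p) := by
          refine Finset.expect_le_expect fun x _ => ?_
          have := h0 x
          split_ifs <;> linarith
      _ = 𝔼 x, (2 * p' x - p) + p := by
          rw [Finset.expect_add_distrib, Fintype.expect_const]
      _ ≤ _ := by
          rw [add_mul, one_div_mul_eq_div]
          linarith
  · have : ∀ x, ¬ M < p' x := fun x => by linarith [hle x]
    simp [this]

end Truncation

/-! ### Chaining along random halvings -/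

/-- An index set with `2 ^ s` elements, built by successive doubling. -/
def Idx : ℕ → Type
  | 0 => Unit
  | s + 1 => Idx s × Bool

instance Idx.instFintype : ∀ s, Fintype (Idx s)
  | 0 => inferInstanceAs (Fintype Unit)
  | s + 1 => have := Idx.instFintype s; inferInstanceAs (Fintype (Idx s × Bool))

instance Idx.instDecidableEq : ∀ s, DecidableEq (Idx s)
  | 0 => inferInstanceAs (DecidableEq Unit)
  | s + 1 => have := Idx.instDecidableEq s; inferInstanceAs (DecidableEq (Idx s × Bool))

lemma Idx.card (s : ℕ) : Fintype.card (Idx s) = 2 ^ s := by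
  induction s with
  | zero => rfl
  | succ s ih =>
    change Fintype.card (Idx s × Bool) = _
    rw [Fintype.card_prod, ih, Fintype.card_bool, pow_succ]

lemma sqrt_mul_add_sqrt_mul_le {a b c d : ℝ} (ha : 0 ≤ a) (hb : 0 ≤ b) (hc : 0 ≤ c)
    (hd : 0 ≤ d) : √a * √b + √c * √d ≤ √(a + c) * √(b + d) := by
  rw [← Real.sqrt_mul (by positivity : 0 ≤ a + c)]
  apply Real.le_sqrt_of_sq_le
  nlinarith [sq_nonneg (√a * √d - √c * √b), Real.sq_sqrt ha, Real.sq_sqrt hb, Real.sq_sqrt hc,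
    Real.sq_sqrt hd, mul_pow (√a) (√b) 2, mul_pow (√c) (√d) 2, mul_pow (√a) (√d) 2,
    mul_pow (√c) (√b) 2]

section Chaining

variable {ι J W F : Type*} [Fintype ι] [Fintype J] [Fintype F] [DecidableEq F]

/-- The plurality in coordinate `j` of the words on the list `ℓ`. -/
def wordPlur (w : W → J → Option F) (ℓ : ι → W) (j : J) : ℝ := plur fun i => w (ℓ i) j

/-- The change of the truncated pluralities under halving. -/
def increment (M : ℝ) (w : W → J → Option F) (x : (ι × Bool → W) × (ι → Bool)) (j : J) : ℝ :=
  trunc M (wordPlur w x.1 j) - 2 * trunc M (wordPlur w (half x.1 x.2) j)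

/-- The total of the pluralities that exceed `M`. -/
noncomputable def heavySum (M : ℝ) (w : W → J → Option F) (ℓ : ι → W) : ℝ :=
  ∑ j, heavy M (wordPlur w ℓ j)

omit [Fintype J] in
lemma wordPlur_nonneg (w : W → J → Option F) (ℓ : ι → W) (j : J) : 0 ≤ wordPlur w ℓ j :=
  Nat.cast_nonneg _

lemma heavySum_nonneg (M : ℝ) (w : W → J → Option F) (ℓ : ι → W) : 0 ≤ heavySum M w ℓ :=
  Finset.sum_nonneg fun _ _ => heavy_nonneg (wordPlur_nonneg _ _ _)

omit [Fintype J] in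
lemma expect_sq_wordPlur_sub_le [DecidableEq ι] {m : ℝ}
    (hm : Real.log (4 * Fintype.card ι) ≤ 2 * m) (w : W → J → Option F) (ℓ : ι × Bool → W)
    (j : J) : 𝔼 ε, (wordPlur w ℓ j - 2 * wordPlur w (half ℓ ε) j) ^ 2 ≤
      8 * m * wordPlur w ℓ j := by
  have h := expect_sq_plur_sub_le fun i => w (ℓ i) j
  have h2 := mul_le_mul_of_nonneg_left hm (wordPlur_nonneg w ℓ j)
  refine h.trans ?_
  unfold wordPlur at *
  linarith

omit [Fintype J] in
lemma wordPlur_half_le (w : W → J → Option F) (ℓ : ι × Bool → W) (ε : ι → Bool) (j : J) :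
    wordPlur w (half ℓ ε) j ≤ wordPlur w ℓ j :=
  Nat.cast_le.2 (plur_half_le (fun i => w (ℓ i) j) ε)

/-- A single halving must control both the squared increments and the heavy sum of the half.
Averaging a weighted combination of the two achieves this. -/
lemma exists_half_le [DecidableEq ι] {m M c K : ℝ} (hm : 1 ≤ m) (hM : M = 8 * m ^ 3)
    (hι : Real.log (4 * Fintype.card ι) ≤ 2 * m) (hc : 0 ≤ c) (hK : 0 ≤ K)
    (w : W → J → Option F) (ℓ : ι × Bool → W) :
    ∃ ε, c * ∑ j, increment M w (ℓ, ε) j ^ 2 + 4 * K * heavySum M w (half ℓ ε) ≤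
      (c * (4 * M) + 2 * (1 + 1 / m) * K) * heavySum M w ℓ := by
  have key : 𝔼 ε, (c * ∑ j, increment M w (ℓ, ε) j ^ 2 + 4 * K * heavySum M w (half ℓ ε)) ≤
      (c * (4 * M) + 2 * (1 + 1 / m) * K) * heavySum M w ℓ := by
    have h1 : 𝔼 ε, ∑ j, increment M w (ℓ, ε) j ^ 2 ≤ 4 * M * heavySum M w ℓ := by
      rw [Finset.expect_sum_comm, heavySum, Finset.mul_sum]
      exact Finset.sum_le_sum fun j _ => expect_sq_trunc_sub_le
        (p := wordPlur w ℓ j) (p' := fun ε => wordPlur w (half ℓ ε) j) hm hM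
        (fun ε => wordPlur_half_le w ℓ ε j) (expect_sq_wordPlur_sub_le hι w ℓ j)
    have h2 : 𝔼 ε, 2 * heavySum M w (half ℓ ε) ≤ (1 + 1 / m) * heavySum M w ℓ := by
      simp only [heavySum, Finset.mul_sum]
      rw [Finset.expect_sum_comm]
      exact Finset.sum_le_sum fun j _ => expect_heavy_le
        (p := wordPlur w ℓ j) (p' := fun ε => wordPlur w (half ℓ ε) j) hm hM (fun ε => wordPlur_nonneg _ _ _)
        (fun ε => wordPlur_half_le w ℓ ε j) (expect_sq_wordPlur_sub_le hι w ℓ j)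
    rw [Finset.expect_add_distrib, ← Finset.mul_expect, ← Finset.mul_expect]
    rw [← Finset.mul_expect] at h2
    nlinarith [mul_le_mul_of_nonneg_left h1 hc, mul_le_mul_of_nonneg_left h2 hK]
  obtain ⟨ε, -, hε⟩ := Finset.exists_le_of_expect_le Finset.univ_nonempty key
  exact ⟨ε, hε⟩

/-- The constants of the chaining argument at level `s`. -/
noncomputable def chainConst (m M : ℝ) : ℕ → ℝ
  | 0 => 0
  | s + 1 => 2 ^ s * (4 * M) + 2 * (1 + 1 / m) * chainConst m M s

lemma chainConst_nonneg {m M : ℝ} (hm : 0 ≤ m) (hM : 0 ≤ M) : ∀ s, 0 ≤ chainConst m M s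
  | 0 => le_rfl
  | s + 1 => by
    have := chainConst_nonneg hm hM s
    rw [chainConst]
    positivity

/-- Divided by `2 ^ s * (1 + 1 / m) ^ s`, the constants grow by at most `2 * M` per level. -/
lemma chainConst_le {m M : ℝ} (hm : 0 < m) (hM : 0 ≤ M) (s : ℕ) :
    chainConst m M s ≤ 2 ^ s * (2 * M) * s * (1 + 1 / m) ^ s := by
  induction s with
  | zero => simp [chainConst]
  | succ s ih =>
    have h1 : (1 : ℝ) ≤ (1 + 1 / m) ^ (s + 1) :=
      one_le_pow₀ (by linarith [one_div_pos.2 hm])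
    calc chainConst m M (s + 1)
        ≤ 2 ^ s * (4 * M) * 1 +
          2 * (1 + 1 / m) * (2 ^ s * (2 * M) * s * (1 + 1 / m) ^ s) := by
          rw [chainConst, mul_one]
          gcongr
      _ ≤ 2 ^ s * (4 * M) * (1 + 1 / m) ^ (s + 1) +
          2 * (1 + 1 / m) * (2 ^ s * (2 * M) * s * (1 + 1 / m) ^ s) := by gcongr
      _ = _ := by push_cast; ring

lemma chainConst_self_le {m : ℕ} (hm : 1 ≤ m) {M : ℝ} (hM : 0 ≤ M) :
    chainConst m M m ≤ 2 ^ m * (6 * M * m) := by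
  have hm' : (0 : ℝ) < m := by exact_mod_cast hm
  have h3 : (1 + 1 / (m : ℝ)) ^ m ≤ 3 := by
    calc (1 + 1 / (m : ℝ)) ^ m ≤ Real.exp (1 / m) ^ m := by
          gcongr
          linarith [Real.add_one_le_exp (1 / (m : ℝ))]
      _ = Real.exp 1 := by
          rw [← Real.exp_nat_mul]
          congr 1
          field_simp
      _ ≤ 3 := by linarith [Real.exp_one_lt_d9]
  calc _ ≤ _ := chainConst_le hm' hM m
    _ ≤ 2 ^ m * (2 * M) * m * 3 := by gcongr
    _ = _ := by ring

/-- The accumulated normalized fluctuation of the increments below level `s`. -/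
noncomputable def chainSup (M : ℝ) (w : W → J → Option F) (η : J → Bool) (s : ℕ) : ℝ :=
  ∑ r ∈ Finset.range s,
    maxSq (increment M w : (Idx r × Bool → W) × (Idx r → Bool) → J → ℝ) η / 2 ^ r

lemma chainSup_nonneg (M : ℝ) (w : W → J → Option F) (η : J → Bool) (s : ℕ) :
    0 ≤ chainSup M w η s :=
  Finset.sum_nonneg fun _ _ => div_nonneg (maxSq_nonneg _ _) (by positivity)

lemma log_four_mul_card_idx_le {s m : ℕ} (hs : s + 1 ≤ m) :
    Real.log (4 * Fintype.card (Idx s)) ≤ 2 * m := by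
  have hs' : ((s : ℝ) + 1) ≤ m := by exact_mod_cast hs
  rw [Idx.card, show (4 : ℝ) * ((2 ^ s : ℕ) : ℝ) = 2 ^ (s + 2) by push_cast; ring, Real.log_pow]
  push_cast
  nlinarith [Real.log_two_lt_d9, Real.log_two_gt_d9]

/-- Telescoping along halvings. Cauchy–Schwarz at each level separates the randomness of `η`,
collected in `chainSup`, from the size of the list, collected in `chainConst` and `heavySum`. -/
lemma signedSum_trunc_le [Finite W] {m : ℕ} {M : ℝ} (hm : 1 ≤ m) (hM : M = 8 * (m : ℝ) ^ 3)
    (w : W → J → Option F) (η : J → Bool) (s : ℕ) (hs : s ≤ m) (ℓ : Idx s → W) :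
    signedSum η (fun j => trunc M (wordPlur w ℓ j)) ≤
      √(chainSup M w η s) * √(chainConst m M s * heavySum M w ℓ) := by
  have hm' : (1 : ℝ) ≤ m := by exact_mod_cast hm
  have hm3 : (1 : ℝ) ≤ (m : ℝ) ^ 3 := one_le_pow₀ hm'
  induction s with
  | zero =>
    -- The chain ends here: a list of one word has plurality at most `1`, below the threshold.
    have h : ∀ j, trunc M (wordPlur w ℓ j) = 0 := fun j => by
      have h1 : wordPlur w ℓ j ≤ 1 := by
        unfold wordPlur plur mult
        have : (Finset.univ.sup fun α : F =>
            (Finset.univ.filter fun i => w (ℓ i) j = some α).card) ≤ 1 :=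
          Finset.sup_le fun α _ => (Finset.card_filter_le _ _).trans (Idx.card 0).le
        exact_mod_cast this
      exact max_eq_right (by linarith)
    simp only [h, signedSum, mul_zero, Finset.sum_const_zero]
    positivity
  | succ s ih =>
    have hK : 0 ≤ chainConst m M s := chainConst_nonneg (by linarith) (by linarith) s
    -- The weight `2 ^ s` offsets the factor `1 / 2 ^ s` in `chainSup`.
    obtain ⟨ε, hε⟩ := exists_half_le (c := 2 ^ s) hm' hM (log_four_mul_card_idx_le hs)
      (by positivity) hK w ℓ
    have ih' := ih (by omega) (half ℓ ε)
    have hφ : 0 ≤ heavySum M w (half ℓ ε) := heavySum_nonneg _ _ _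
    have hU := signedSum_le_sqrt_maxSq
      (increment M w : (Idx s × Bool → W) × (Idx s → Bool) → J → ℝ) η (ℓ, ε)
    set U := maxSq (increment M w : (Idx s × Bool → W) × (Idx s → Bool) → J → ℝ) η with hUdef
    set S := ∑ j, increment M w (ℓ, ε) j ^ 2 with hSdef
    have hU0 : 0 ≤ U := maxSq_nonneg _ _
    have hS0 : 0 ≤ S := Finset.sum_nonneg fun _ _ => sq_nonneg _
    have hV0 := chainSup_nonneg M w η s
    have hsplit : signedSum η (fun j => trunc M (wordPlur w ℓ j)) =
        signedSum η (increment M w (ℓ, ε)) +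
          2 * signedSum η (fun j => trunc M (wordPlur w (half ℓ ε) j)) := by
      rw [← signedSum_smul, ← signedSum_add]
      congr 1
      exact funext fun j => (sub_add_cancel _ _).symm
    have e1 : √(U * S) = √(U / 2 ^ s) * √(2 ^ s * S) := by
      rw [← Real.sqrt_mul (by positivity)]
      congr 1
      field_simp
    have e2 : 2 * √(chainConst m M s * heavySum M w (half ℓ ε)) =
        √(4 * chainConst m M s * heavySum M w (half ℓ ε)) := by
      rw [mul_assoc, Real.sqrt_mul (by norm_num : (0 : ℝ) ≤ 4),
        show (4 : ℝ) = 2 ^ 2 by norm_num, Real.sqrt_sq (by norm_num)]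
    rw [hsplit]
    calc _ ≤ √(U / 2 ^ s) * √(2 ^ s * S) + √(chainSup M w η s) *
          √(4 * chainConst m M s * heavySum M w (half ℓ ε)) := by
          rw [← e1, ← e2]
          linarith
      _ ≤ √(U / 2 ^ s + chainSup M w η s) *
          √(2 ^ s * S + 4 * chainConst m M s * heavySum M w (half ℓ ε)) :=
          sqrt_mul_add_sqrt_mul_le (by positivity) (by positivity) hV0 (by positivity)
      _ ≤ _ := by
          have e3 : U / 2 ^ s + chainSup M w η s = chainSup M w η (s + 1) := by
            rw [chainSup, chainSup, Finset.sum_range_succ, add_comm]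
          rw [e3]
          gcongr
          exact hε

/-- Level `r` has `|W| ^ 2 ^ (r + 1) * 2 ^ 2 ^ r` increments. The logarithm is of order `2 ^ r * log
|W|`, so after division by `2 ^ r` all levels contribute equally. -/
lemma expect_chainSup_le [DecidableEq J] [Fintype W] (hW : 2 ≤ Fintype.card W) (M : ℝ)
    (w : W → J → Option F) (s : ℕ) :
    𝔼 η, chainSup M w η s ≤ 16 * Real.log (Fintype.card W) * s := by
  classical
  have hWr : (2 : ℝ) ≤ Fintype.card W := by exact_mod_cast hW
  have hl2 : Real.log 2 ≤ Real.log (Fintype.card W) := Real.log_le_log (by norm_num) hWr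
  have hl : 0 < Real.log 2 := Real.log_pos (by norm_num)
  have : Nonempty W := Fintype.card_pos_iff.1 (by omega)
  unfold chainSup
  rw [Finset.expect_sum_comm]
  calc _ ≤ ∑ r ∈ Finset.range s, 16 * Real.log (Fintype.card W) := by
        refine Finset.sum_le_sum fun r _ => ?_
        rw [← Finset.expect_div, div_le_iff₀ (by positivity)]
        refine (expect_maxSq_le _).trans ?_
        rw [Fintype.card_prod, Fintype.card_fun, Fintype.card_fun, Fintype.card_prod,
          Fintype.card_bool, Idx.card]
        push_cast
        rw [Real.log_mul (by norm_num) (by positivity), Real.log_mul (by positivity)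
          (by positivity), Real.log_pow, Real.log_pow]
        push_cast
        have h1 : (1 : ℝ) ≤ 2 ^ r := one_le_pow₀ (by norm_num)
        nlinarith [mul_le_mul_of_nonneg_right h1 (hl.le.trans hl2),
          mul_le_mul_of_nonneg_left hl2 (by positivity : (0 : ℝ) ≤ 2 ^ r)]
    _ = _ := by simp [mul_comm]

/-- The main estimate: the Rademacher process of total pluralities of lists of words. -/
theorem expect_iSup_signedSum_wordPlur_le [DecidableEq J] [Fintype W] {τ : Type*} [Finite τ]
    [Nonempty τ] {m : ℕ} (hm : 1 ≤ m) (hW : 2 ≤ Fintype.card W) (w : W → J → Option F)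
    (ℓ : τ → Idx m → W) {Q : ℝ} (hQ : ∀ t, ∑ j, wordPlur w (ℓ t) j ≤ Q) :
    𝔼 η, ⨆ t, signedSum η (wordPlur w (ℓ t)) ≤
      36 * √(2 ^ m * Real.log (Fintype.card W) * Q * m ^ 5) := by
  classical
  have hm' : (1 : ℝ) ≤ m := by exact_mod_cast hm
  obtain ⟨M, hM⟩ : ∃ M : ℝ, M = 8 * (m : ℝ) ^ 3 := ⟨_, rfl⟩
  have hM0 : 0 ≤ M := by rw [hM]; positivity
  have hWr : (2 : ℝ) ≤ Fintype.card W := by exact_mod_cast hW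
  have hl2 : Real.log 2 ≤ Real.log (Fintype.card W) := Real.log_le_log (by norm_num) hWr
  have hl : 0 < Real.log 2 := Real.log_pos (by norm_num)
  have hne : Nonempty W := Fintype.card_pos_iff.1 (by omega)
  obtain ⟨t₀⟩ := ‹Nonempty τ›
  have hQ0 : 0 ≤ Q := (Finset.sum_nonneg fun j _ => wordPlur_nonneg w (ℓ t₀) j).trans (hQ t₀)
  have : Nonempty τ := ⟨t₀⟩
  set B := Real.log (Fintype.card W) with hB
  have hB0 : 0 < B := hl.trans_le hl2
  let low : (Idx m → W) → J → ℝ := fun ℓ j => min (wordPlur w ℓ j) M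
  have hpt : ∀ η, ⨆ t, signedSum η (wordPlur w (ℓ t)) ≤
      √(maxSq low η) * √(M * Q) + √(chainSup M w η m) * √(chainConst m M m * Q) := by
    intro η
    refine ciSup_le fun t => ?_
    have hsplit : signedSum η (wordPlur w (ℓ t)) =
        signedSum η (low (ℓ t)) + signedSum η (fun j => trunc M (wordPlur w (ℓ t) j)) := by
      rw [← signedSum_add]
      congr 1
      funext j
      simp only [low, trunc]
      rcases le_total (wordPlur w (ℓ t) j) M with h | h
      · rw [min_eq_left h, max_eq_right (by linarith), add_zero]
      · rw [min_eq_right h, max_eq_left (by linarith)]; ring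
    rw [hsplit]
    refine add_le_add ((signedSum_le_sqrt_maxSq low η (ℓ t)).trans ?_)
      ((signedSum_trunc_le hm hM w η m le_rfl (ℓ t)).trans ?_)
    · rw [← Real.sqrt_mul (maxSq_nonneg _ _)]
      refine Real.sqrt_le_sqrt (mul_le_mul_of_nonneg_left ?_ (maxSq_nonneg _ _))
      refine le_trans ?_ (mul_le_mul_of_nonneg_left (hQ t) hM0)
      rw [Finset.mul_sum]
      refine Finset.sum_le_sum fun j _ => ?_
      rw [sq]
      have h0 := wordPlur_nonneg w (ℓ t) j
      exact mul_le_mul (min_le_right _ _) (min_le_left _ _) (le_min h0 hM0) hM0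
    · gcongr
      · exact chainConst_nonneg (by linarith) hM0 m
      · exact (Finset.sum_le_sum fun j _ => heavy_le (wordPlur_nonneg _ _ _)).trans (hQ t)
  have h1 : 𝔼 η, √(maxSq low η) ≤ √(8 * 2 ^ m * B) := by
    refine (expect_sqrt_le _ fun η => maxSq_nonneg _ _).trans (Real.sqrt_le_sqrt ?_)
    refine (expect_maxSq_le low).trans ?_
    rw [Fintype.card_fun, Idx.card]
    push_cast
    rw [Real.log_mul (by norm_num) (by positivity), Real.log_pow]
    push_cast
    have h1 : (1 : ℝ) ≤ 2 ^ m := one_le_pow₀ (by norm_num)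
    nlinarith [mul_le_mul_of_nonneg_right h1 hB0.le]
  have h2 : 𝔼 η, √(chainSup M w η m) ≤ √(16 * B * m) :=
    (expect_sqrt_le _ fun η => chainSup_nonneg _ _ _ _).trans
      (Real.sqrt_le_sqrt (expect_chainSup_le hW M w m))
  have h3 : √(8 * 2 ^ m * B) * √(M * Q) ≤ 8 * √(2 ^ m * B * Q * m ^ 5) := by
    rw [← Real.sqrt_mul (by positivity), show (8 : ℝ) = √(8 ^ 2) by
      rw [Real.sqrt_sq (by norm_num)], ← Real.sqrt_mul (by positivity)]
    rw [Real.sqrt_sq (by norm_num), hM]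
    apply Real.sqrt_le_sqrt
    have h5 : (m : ℝ) ^ 3 ≤ m ^ 5 := pow_le_pow_right₀ hm' (by norm_num)
    have := mul_le_mul_of_nonneg_left h5 (by positivity : 0 ≤ 2 ^ m * B * Q)
    nlinarith
  have h4 : √(16 * B * m) * √(chainConst m M m * Q) ≤ 28 * √(2 ^ m * B * Q * m ^ 5) := by
    rw [← Real.sqrt_mul (by positivity)]
    apply Real.sqrt_le_iff.2 ⟨by positivity, ?_⟩
    rw [mul_pow, Real.sq_sqrt (by positivity)]
    have hK := chainConst_self_le hm hM0
    calc 16 * B * m * (chainConst m M m * Q) ≤ 16 * B * m * (2 ^ m * (6 * M * m) * Q) := by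
          gcongr
      _ = 768 * (2 ^ m * B * Q * m ^ 5) := by rw [hM]; ring
      -- `768 ≤ 28 ^ 2`.
      _ ≤ _ := by
          apply mul_le_mul_of_nonneg_right (by norm_num) (by positivity)
  calc _ ≤ 𝔼 η, (√(maxSq low η) * √(M * Q) +
        √(chainSup M w η m) * √(chainConst m M m * Q)) :=
        Finset.expect_le_expect fun η _ => hpt η
    _ = (𝔼 η, √(maxSq low η)) * √(M * Q) +
        (𝔼 η, √(chainSup M w η m)) * √(chainConst m M m * Q) := by
        rw [Finset.expect_add_distrib, Finset.expect_mul, Finset.expect_mul]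
    _ ≤ √(8 * 2 ^ m * B) * √(M * Q) + √(16 * B * m) * √(chainConst m M m * Q) := by gcongr
    _ ≤ _ := by linarith

end Chaining

/-! ### Symmetrization for finite product distributions -/

section Symmetrization

variable {J κ τ : Type*} [Fintype J] [DecidableEq J] [Fintype κ] {p : J → κ → ℝ}

/-- The weight of `g` under the product distribution with marginals `p`. -/
def prodWeight (p : J → κ → ℝ) (g : J → κ) : ℝ := ∏ j, p j (g j)

/-- The expectation of `X` under the product distribution with marginals `p`. -/
def prodExpect (p : J → κ → ℝ) (X : (J → κ) → ℝ) : ℝ := ∑ g, prodWeight p g * X g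

omit [DecidableEq J] [Fintype κ] in
lemma prodWeight_nonneg (hp : ∀ j c, 0 ≤ p j c) (g : J → κ) : 0 ≤ prodWeight p g :=
  Finset.prod_nonneg fun _ _ => hp _ _

lemma sum_prodWeight (hp1 : ∀ j, ∑ c, p j c = 1) : ∑ g, prodWeight p g = 1 := by
  have := Finset.prod_univ_sum (fun _ : J => (Finset.univ : Finset κ)) p
  rw [Fintype.piFinset_univ] at this
  simpa [prodWeight, hp1] using this.symm

lemma prodExpect_mono_of_support (hp : ∀ j c, 0 ≤ p j c) {X Y : (J → κ) → ℝ}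
    (h : ∀ g, prodWeight p g ≠ 0 → X g ≤ Y g) : prodExpect p X ≤ prodExpect p Y := by
  refine Finset.sum_le_sum fun g _ => ?_
  rcases eq_or_ne (prodWeight p g) 0 with h0 | h0
  · simp [h0]
  · exact mul_le_mul_of_nonneg_left (h g h0) (prodWeight_nonneg hp g)

lemma prodExpect_add (X Y : (J → κ) → ℝ) :
    prodExpect p (fun g => X g + Y g) = prodExpect p X + prodExpect p Y := by
  simp [prodExpect, mul_add, Finset.sum_add_distrib]

lemma prodExpect_const (hp1 : ∀ j, ∑ c, p j c = 1) (b : ℝ) : prodExpect p (fun _ => b) = b := by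
  simp [prodExpect, ← Finset.sum_mul, sum_prodWeight hp1]

lemma prodExpect_sqrt_le (hp : ∀ j c, 0 ≤ p j c) (hp1 : ∀ j, ∑ c, p j c = 1)
    (X : (J → κ) → ℝ) (hX : ∀ g, 0 ≤ X g) :
    prodExpect p (fun g => √(X g)) ≤ √(prodExpect p X) := by
  apply Real.le_sqrt_of_sq_le
  have := Finset.sum_mul_sq_le_sq_mul_sq Finset.univ
    (fun g => √(prodWeight p g)) (fun g => √(prodWeight p g) * √(X g))
  simp only [← mul_assoc, mul_pow, Real.mul_self_sqrt (prodWeight_nonneg hp _),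
    Real.sq_sqrt (prodWeight_nonneg hp _), Real.sq_sqrt (hX _), sum_prodWeight hp1,
    one_mul] at this
  exact this

/-- Exchange the coordinates of `g` and `g'` at which the bit of `η` is false. -/
def swapAt (η : J → Bool) : Equiv.Perm ((J → κ) × (J → κ)) where
  toFun x := (fun j => cond (η j) (x.1 j) (x.2 j), fun j => cond (η j) (x.2 j) (x.1 j))
  invFun x := (fun j => cond (η j) (x.1 j) (x.2 j), fun j => cond (η j) (x.2 j) (x.1 j))
  left_inv x := by ext j <;> cases h : η j <;> simp [h]
  right_inv x := by ext j <;> cases h : η j <;> simp [h]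

omit [DecidableEq J] [Fintype κ] in
lemma prodWeight_swapAt (η : J → Bool) (x : (J → κ) × (J → κ)) :
    prodWeight p (swapAt η x).1 * prodWeight p (swapAt η x).2 =
      prodWeight p x.1 * prodWeight p x.2 := by
  simp only [prodWeight, ← Finset.prod_mul_distrib]
  refine Finset.prod_congr rfl fun j _ => ?_
  cases h : η j <;> simp [swapAt, h, mul_comm]

omit [DecidableEq J] [Fintype κ] in
lemma sum_sub_swapAt (η : J → Bool) (f : J → κ → ℝ) (x : (J → κ) × (J → κ)) :
    ∑ j, (f j ((swapAt η x).1 j) - f j ((swapAt η x).2 j)) =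
      signedSum η (fun j => f j (x.1 j)) + signedSum (fun j => !η j) fun j => f j (x.2 j) := by
  rw [signedSum, signedSum, ← Finset.sum_add_distrib]
  refine Finset.sum_congr rfl fun j _ => ?_
  cases h : η j <;> simp [swapAt, h, sgn] <;> ring

/-- The Rademacher supremum of the process `f` at the point `g`. -/
noncomputable def signedSup (f : τ → J → κ → ℝ) (η : J → Bool) (g : J → κ) : ℝ :=
  ⨆ t, signedSum η fun j => f t j (g j)

lemma sum_prodWeight_mul_le [Finite τ] [Nonempty τ] (hp : ∀ j c, 0 ≤ p j c)
    (hp1 : ∀ j, ∑ c, p j c = 1) (f : τ → J → κ → ℝ) (η : J → Bool) :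
    ∑ x : (J → κ) × (J → κ), prodWeight p x.1 * prodWeight p x.2 *
        ⨆ t, ∑ j, (f t j (x.1 j) - f t j (x.2 j)) ≤
      prodExpect p (signedSup f η) + prodExpect p (signedSup f fun j => !η j) := by
  -- Swapping coordinates between two independent copies preserves their joint law and only changes
  -- signs in the difference.
  rw [← Equiv.sum_comp (swapAt η)]
  simp only [prodWeight_swapAt, sum_sub_swapAt]
  calc _ ≤ ∑ x : (J → κ) × (J → κ), (prodWeight p x.2 * (prodWeight p x.1 * signedSup f η x.1) +
        prodWeight p x.1 * (prodWeight p x.2 * signedSup f (fun j => !η j) x.2)) := by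
        refine Finset.sum_le_sum fun x _ => ?_
        have h : (⨆ t, (signedSum η (fun j => f t j (x.1 j)) +
            signedSum (fun j => !η j) fun j => f t j (x.2 j))) ≤
            signedSup f η x.1 + signedSup f (fun j => !η j) x.2 :=
          ciSup_le fun t => add_le_add
            (le_ciSup (f := fun t => signedSum η fun j => f t j (x.1 j))
              (Set.finite_range _).bddAbove t)
            (le_ciSup (f := fun t => signedSum (fun j => !η j) fun j => f t j (x.2 j))
              (Set.finite_range _).bddAbove t)
        have := mul_le_mul_of_nonneg_left h
          (mul_nonneg (prodWeight_nonneg hp x.1) (prodWeight_nonneg hp x.2))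
        linarith
    _ = _ := by
        rw [Finset.sum_add_distrib, Fintype.sum_prod_type_right, Fintype.sum_prod_type]
        simp only [← Finset.mul_sum, ← Finset.sum_mul, sum_prodWeight hp1, one_mul]
        rfl

/-- Symmetrization: the expected supremum of a sum of independent contributions exceeds the
supremum of the expectations by at most twice the expected Rademacher supremum. -/
theorem prodExpect_iSup_le [Finite τ] [Nonempty τ] (hp : ∀ j c, 0 ≤ p j c)
    (hp1 : ∀ j, ∑ c, p j c = 1) (f : τ → J → κ → ℝ) :
    prodExpect p (fun g : J → κ => ⨆ t, ∑ j, f t j (g j)) ≤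
      (⨆ t, prodExpect p fun g : J → κ => ∑ j, f t j (g j)) +
        2 * prodExpect p (fun g => 𝔼 η, signedSup f η g) := by
  set E := ⨆ t, prodExpect p fun g : J → κ => ∑ j, f t j (g j) with hE
  set D := ∑ x : (J → κ) × (J → κ), prodWeight p x.1 * prodWeight p x.2 *
    ⨆ t, ∑ j, (f t j (x.1 j) - f t j (x.2 j)) with hD
  have h1 : prodExpect p (fun g : J → κ => ⨆ t, ∑ j, f t j (g j)) ≤ E + D := by
    have : ∀ g : J → κ, (⨆ t, ∑ j, f t j (g j)) ≤
        E + prodExpect p fun g' => ⨆ t, ∑ j, (f t j (g j) - f t j (g' j)) := by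
      intro g
      refine ciSup_le fun t => ?_
      calc ∑ j, f t j (g j) = prodExpect p (fun _ => ∑ j, f t j (g j)) :=
            (prodExpect_const hp1 _).symm
        _ ≤ prodExpect p (fun g' => ∑ j, f t j (g' j) +
              ⨆ t, ∑ j, (f t j (g j) - f t j (g' j))) := by
            refine prodExpect_mono_of_support hp fun g' _ => ?_
            have := le_ciSup (f := fun t => ∑ j, (f t j (g j) - f t j (g' j)))
              (Set.finite_range _).bddAbove t
            simp only [Finset.sum_sub_distrib] at this ⊢
            linarith
        _ ≤ _ := by
            rw [prodExpect_add]
            gcongr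
            exact le_ciSup (f := fun t => prodExpect p fun g : J → κ => ∑ j, f t j (g j))
              (Set.finite_range _).bddAbove t
    refine (prodExpect_mono_of_support hp fun g _ => this g).trans ?_
    rw [prodExpect_add, prodExpect_const hp1, hD, Fintype.sum_prod_type]
    simp only [prodExpect, Finset.mul_sum, mul_assoc, le_refl]
  have h2 : D ≤ 𝔼 η, (prodExpect p (signedSup f η) +
      prodExpect p (signedSup f fun j => !η j)) :=
    Finset.le_expect Finset.univ_nonempty fun η _ => sum_prodWeight_mul_le hp hp1 f η
  have h3 : 𝔼 η : J → Bool, prodExpect p (signedSup f fun j => !η j) =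
      𝔼 η : J → Bool, prodExpect p (signedSup f η) :=
    Fintype.expect_equiv (Equiv.piCongrRight fun _ => Equiv.boolNot) _ _ fun η => rfl
  have h4 : 𝔼 η : J → Bool, prodExpect p (signedSup f η) =
      prodExpect p fun g => 𝔼 η, signedSup f η g := by
    simp only [prodExpect, Finset.mul_expect]
    rw [Finset.expect_sum_comm]
  rw [Finset.expect_add_distrib, h3, h4] at h2
  linarith

/-- The quadratic inequality in `√q` forces `√q ≤ √E + √a`; this is substituted back into the
hypothesis. -/
lemma le_add_add_sqrt_of_le_add_sqrt {q E a : ℝ} (hq : 0 ≤ q) (hE : 0 ≤ E) (ha : 0 ≤ a)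
    (h : q ≤ E + √(a * q)) : q ≤ E + a + √(E * a) := by
  rw [Real.sqrt_mul ha] at h
  rw [Real.sqrt_mul hE]
  have h1 : √q ≤ √E + √a := by
    by_contra! hlt
    nlinarith [Real.sq_sqrt hq, Real.sq_sqrt hE, Real.sq_sqrt ha, Real.sqrt_nonneg q,
      Real.sqrt_nonneg E, Real.sqrt_nonneg a, mul_nonneg (Real.sqrt_nonneg E) (Real.sqrt_nonneg a)]
  nlinarith [Real.sq_sqrt ha, Real.sqrt_nonneg a]

theorem prodExpect_iSup_le_of_expect_signedSup_le [Finite τ] [Nonempty τ]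
    (hp : ∀ j c, 0 ≤ p j c) (hp1 : ∀ j, ∑ c, p j c = 1) (f : τ → J → κ → ℝ)
    (hf : ∀ t j c, 0 ≤ f t j c) {a : ℝ} (ha : 0 ≤ a)
    (h : ∀ g, prodWeight p g ≠ 0 →
      2 * 𝔼 η, signedSup f η g ≤ √(a * ⨆ t, ∑ j, f t j (g j))) :
    prodExpect p (fun g : J → κ => ⨆ t, ∑ j, f t j (g j)) ≤
      (⨆ t, prodExpect p fun g : J → κ => ∑ j, f t j (g j)) + a +
        √((⨆ t, prodExpect p fun g : J → κ => ∑ j, f t j (g j)) * a) := by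
  have hsum : ∀ t (g : J → κ), 0 ≤ ∑ j, f t j (g j) :=
    fun t g => Finset.sum_nonneg fun _ _ => hf _ _ _
  have hsup : ∀ g : J → κ, 0 ≤ ⨆ t, ∑ j, f t j (g j) :=
    fun g => Real.iSup_nonneg fun t => hsum t g
  have hexp : ∀ X : (J → κ) → ℝ, (∀ g, 0 ≤ X g) → 0 ≤ prodExpect p X := fun X hX =>
    Finset.sum_nonneg fun g _ => mul_nonneg (prodWeight_nonneg hp g) (hX g)
  refine le_add_add_sqrt_of_le_add_sqrt (hexp _ hsup)
    (Real.iSup_nonneg fun t => hexp _ (hsum t)) ha ?_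
  refine (prodExpect_iSup_le hp hp1 f).trans (add_le_add le_rfl ?_)
  have e : ∀ (b : ℝ) (X : (J → κ) → ℝ), prodExpect p (fun g => b * X g) = b * prodExpect p X := by
    intro b X
    simp only [prodExpect, Finset.mul_sum]
    exact Finset.sum_congr rfl fun g _ => by ring
  rw [← e, ← e a]
  exact (prodExpect_mono_of_support hp h).trans
    (prodExpect_sqrt_le hp hp1 _ fun g => mul_nonneg ha (hsup g))

end Symmetrization

/-! ### Random linear codes -/

section Code

variable {F : Type*} [Field F] [Fintype F] [DecidableEq F] {k n : ℕ}

/-- The plurality among the symbols that the messages in `Λ` receive from the column `c`. -/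
def colPlur (Λ : Finset (Fin k → F)) (c : Fin k → F) : ℝ :=
  plur fun x : Λ => some (x.1 ⬝ᵥ c)

lemma colPlur_nonneg (Λ : Finset (Fin k → F)) (c : Fin k → F) : 0 ≤ colPlur Λ c :=
  Nat.cast_nonneg _

lemma colPlur_le_card (Λ : Finset (Fin k → F)) (c : Fin k → F) : colPlur Λ c ≤ Λ.card := by
  have : (plur fun x : Λ => some (x.1 ⬝ᵥ c)) ≤ Λ.card :=
    Finset.sup_le fun α _ => (Finset.card_filter_le _ _).trans (by simp)
  exact Nat.cast_le.2 this

lemma card_le_colPlur (Λ : Finset (Fin k → F)) (c : Fin k → F) (α : F)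
    (h : ∀ x ∈ Λ, x ⬝ᵥ c = α) : (Λ.card : ℝ) ≤ colPlur Λ c := by
  refine le_trans (le_of_eq ?_) (Nat.cast_le.2 (mult_le_plur _ α))
  rw [mult, Finset.filter_true_of_mem fun x _ => congrArg some (h x.1 x.2)]
  simp

omit [Fintype F] in
lemma totalAgr_eq (G : Matrix (Fin k) (Fin n) F) (Λ : Finset (Fin k → F)) (z : Fin n → F) :
    totalAgr G Λ z = ∑ j, (mult (fun x : Λ => some (x.1 ⬝ᵥ fun i => G i j)) (z j) : ℝ) := by
  simp only [cast_mult, totalAgr, agr, Finset.card_filter, Nat.cast_sum, Nat.cast_ite,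
    Nat.cast_one, Nat.cast_zero, Option.some.injEq]
  rw [← Finset.sum_coe_sort Λ, Finset.sum_comm]
  rfl

lemma iSup_totalAgr (G : Matrix (Fin k) (Fin n) F) (Λ : Finset (Fin k → F)) :
    ⨆ z, totalAgr G Λ z = ∑ j, colPlur Λ fun i => G i j := by
  apply le_antisymm
  · refine ciSup_le fun z => ?_
    rw [totalAgr_eq]
    exact Finset.sum_le_sum fun j _ => Nat.cast_le.2 (mult_le_plur _ _)
  · have h : ∀ j, ∃ α, plur (fun x : Λ => some (x.1 ⬝ᵥ fun i => G i j)) =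
        mult (fun x : Λ => some (x.1 ⬝ᵥ fun i => G i j)) α := fun j => by
      obtain ⟨α, -, h⟩ := Finset.exists_mem_eq_sup (Finset.univ : Finset F) Finset.univ_nonempty
        (mult fun x : Λ => some (x.1 ⬝ᵥ fun i => G i j))
      exact ⟨α, h⟩
    choose z hz using h
    refine le_trans (le_of_eq ?_) (le_ciSup (Set.finite_range _).bddAbove z)
    rw [totalAgr_eq]
    exact Finset.sum_congr rfl fun j _ => congrArg Nat.cast (hz j)

lemma iSup_iSup_totalAgr (G : Matrix (Fin k) (Fin n) F) {L : ℕ}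
    [Nonempty {Λ : Finset (Fin k → F) // Λ.card = L}] :
    ⨆ z, ⨆ Λ : {Λ : Finset (Fin k → F) // Λ.card = L}, totalAgr G Λ.1 z =
      ⨆ Λ : {Λ : Finset (Fin k → F) // Λ.card = L}, ∑ j, colPlur Λ.1 fun i => G i j := by
  simp only [← iSup_totalAgr]
  apply le_antisymm
  · exact ciSup_le fun z => ciSup_le fun Λ => (le_ciSup (f := fun z => totalAgr G Λ.1 z)
      (Set.finite_range _).bddAbove z).trans
      (le_ciSup (f := fun Λ : {Λ : Finset (Fin k → F) // Λ.card = L} => ⨆ z, totalAgr G Λ.1 z)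
        (Set.finite_range _).bddAbove Λ)
  · exact ciSup_le fun Λ => ciSup_le fun z =>
      (le_ciSup (f := fun Λ : {Λ : Finset (Fin k → F) // Λ.card = L} => totalAgr G Λ.1 z)
        (Set.finite_range _).bddAbove Λ).trans
      (le_ciSup (f := fun z => ⨆ Λ : {Λ : Finset (Fin k → F) // Λ.card = L}, totalAgr G Λ.1 z)
        (Set.finite_range _).bddAbove z)

/-- The codewords of `G` together with the word that has no symbols. -/
def paddedWord (G : Matrix (Fin k) (Fin n) F) : Option (code G) → Fin n → Option F
  | none => fun _ => none
  | some c => fun j => some (c.1 j)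

/-- The encodings of the messages in `Λ`, placed along `e` and padded by `none`. -/
noncomputable def paddedList {ι : Type*} (G : Matrix (Fin k) (Fin n) F)
    (Λ : Finset (Fin k → F)) (e : Λ → ι) (i : ι) : Option (code G) :=
  (Function.partialInv e i).map fun x => ⟨encode G x.1, x.1, rfl⟩

/-- Padding brings the list to length a power of two; `none` carries no symbol, so no plurality
changes. -/
lemma wordPlur_paddedList {ι : Type*} [Fintype ι] (G : Matrix (Fin k) (Fin n) F)
    (Λ : Finset (Fin k → F)) (e : Λ ↪ ι) (j : Fin n) :
    wordPlur (paddedWord G) (paddedList G Λ e) j = colPlur Λ fun i => G i j := by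
  have key : ∀ i, paddedWord G (paddedList G Λ e i) j =
      (Function.partialInv e i).map fun x => x.1 ⬝ᵥ fun i => G i j := fun i => by
    unfold paddedList
    cases Function.partialInv e i <;> rfl
  unfold wordPlur colPlur plur
  simp only [key]
  congr 2
  funext α
  unfold mult
  rw [← Finset.card_map e]
  congr 1
  ext i
  simp only [Finset.mem_filter, Finset.mem_univ, true_and, Finset.mem_map,
    Option.map_eq_some_iff, Option.some.injEq]
  exact exists_congr fun x => and_comm.trans (and_congr_right fun _ => e.injective.isPartialInv x i)

/-- The chaining runs over codewords rather than messages, which yields `log N` in place of `log (q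
^ k)`. -/
lemma expect_signedSup_colPlur_le (G : Matrix (Fin k) (Fin n) F) {L N : ℕ} (hL : 2 ≤ L)
    (hN : 2 ≤ N) (hcode : (code G).ncard ≤ N)
    [Nonempty {Λ : Finset (Fin k → F) // Λ.card = L}] :
    2 * 𝔼 η, signedSup (fun (Λ : {Λ : Finset (Fin k → F) // Λ.card = L}) (_ : Fin n) c =>
      colPlur Λ.1 c) η (fun j i => G i j) ≤ √(errorTerm 663552 L N *
        ⨆ Λ : {Λ : Finset (Fin k → F) // Λ.card = L}, ∑ j, colPlur Λ.1 fun i => G i j) := by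
  classical
  set Q := ⨆ Λ : {Λ : Finset (Fin k → F) // Λ.card = L}, ∑ j, colPlur Λ.1 fun i => G i j with hQ
  have hQ0 : 0 ≤ Q := Real.iSup_nonneg fun Λ => Finset.sum_nonneg fun _ _ => colPlur_nonneg _ _
  obtain ⟨m, hm⟩ : ∃ m, m = Nat.clog 2 L := ⟨_, rfl⟩
  have hLm : L ≤ 2 ^ m := hm ▸ Nat.le_pow_clog (by norm_num) L
  have hm1 : 1 ≤ m := hm ▸ Nat.clog_pos (by norm_num) hL
  have hmL : 2 ^ (m - 1) < L := hm ▸ Nat.pow_pred_clog_lt_self (by norm_num) (by omega)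
  have he : ∀ Λ : {Λ : Finset (Fin k → F) // Λ.card = L}, Nonempty (Λ.1 ↪ Idx m) := fun Λ =>
    Function.Embedding.nonempty_of_card_le (by rw [Idx.card, Fintype.card_coe, Λ.2]; exact hLm)
  let e := fun Λ => (he Λ).some
  have : Fintype (code G) := Fintype.ofFinite _
  have hcard : Fintype.card (Option (code G)) = (code G).ncard + 1 := by
    rw [Fintype.card_option, ← Nat.card_eq_fintype_card, Nat.card_coe_set_eq]
  have hpos : 0 < (code G).ncard := (Set.ncard_pos).2 ⟨_, 0, rfl⟩
  have main := expect_iSup_signedSum_wordPlur_le hm1 (by omega) (paddedWord G)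
    (fun Λ : {Λ : Finset (Fin k → F) // Λ.card = L} => paddedList G Λ.1 (e Λ)) (Q := Q)
    (fun Λ => by
      simp only [wordPlur_paddedList]
      exact le_ciSup (f := fun Λ : {Λ : Finset (Fin k → F) // Λ.card = L} =>
        ∑ j, colPlur Λ.1 fun i => G i j) (Set.finite_range _).bddAbove Λ)
  have hrw : ∀ Λ : {Λ : Finset (Fin k → F) // Λ.card = L},
      wordPlur (paddedWord G) (paddedList G Λ.1 (e Λ)) = fun j => colPlur Λ.1 fun i => G i j :=
    fun Λ => funext fun j => wordPlur_paddedList G Λ.1 (e Λ) j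
  simp only [hrw, hcard] at main
  have hLr : (2 : ℝ) ≤ L := by exact_mod_cast hL
  have hNr : (2 : ℝ) ≤ N := by exact_mod_cast hN
  have hlogL : 1 ≤ Real.logb 2 L := by
    rw [Real.le_logb_iff_rpow_le (by norm_num) (by linarith)]
    simpa using hLr
  have hlogN : 0 ≤ Real.logb 2 N := Real.logb_nonneg (by norm_num) (by linarith)
  have hmlog : (m : ℝ) ≤ 2 * Real.logb 2 L := by
    have h1 : ((m - 1 : ℕ) : ℝ) ≤ Real.logb 2 L := by
      rw [Real.le_logb_iff_rpow_le (by norm_num) (by linarith), Real.rpow_natCast]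
      exact_mod_cast hmL.le
    rw [Nat.cast_sub hm1] at h1
    push_cast at h1
    linarith
  have h2m : (2 : ℝ) ^ m ≤ 2 * L := by
    have : 2 ^ m = 2 * 2 ^ (m - 1) := by
      rw [← pow_succ']
      congr 1
      omega
    exact_mod_cast (by omega : 2 ^ m ≤ 2 * L)
  have hlogW : Real.log (((code G).ncard + 1 : ℕ) : ℝ) ≤ 2 * Real.logb 2 N := by
    -- The padding word accounts for the `+ 1`; `N + 1 ≤ N ^ 2` as `N ≥ 2`.
    have h1 : (((code G).ncard + 1 : ℕ) : ℝ) ≤ (N : ℝ) ^ 2 := by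
      have : (code G).ncard + 1 ≤ N ^ 2 := by nlinarith
      exact_mod_cast this
    have h2 : Real.log N ≤ Real.logb 2 N := by
      rw [Real.logb, le_div_iff₀ (Real.log_pos (by norm_num))]
      nlinarith [Real.log_two_lt_d9, Real.log_nonneg (by linarith : (1 : ℝ) ≤ N)]
    calc _ ≤ Real.log ((N : ℝ) ^ 2) := Real.log_le_log (by positivity) h1
      _ = 2 * Real.log N := by rw [Real.log_pow]; norm_num
      _ ≤ _ := by linarith
  have hlogW0 : 0 ≤ Real.log (((code G).ncard + 1 : ℕ) : ℝ) := Real.log_natCast_nonneg _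
  calc _ ≤ 2 * (36 * √(2 ^ m * Real.log (((code G).ncard + 1 : ℕ) : ℝ) * Q * m ^ 5)) :=
        mul_le_mul_of_nonneg_left main (by norm_num)
    _ ≤ 2 * (36 * √(2 * L * (2 * Real.logb 2 N) * Q * (2 * Real.logb 2 L) ^ 5)) := by gcongr
    _ = √(72 ^ 2 * (2 * L * (2 * Real.logb 2 N) * Q * (2 * Real.logb 2 L) ^ 5)) := by
        rw [Real.sqrt_mul (by norm_num : (0 : ℝ) ≤ 72 ^ 2), Real.sqrt_sq (by norm_num)]
        ring
    -- `663552 = 72 ^ 2 * 2 * 2 * 2 ^ 5`.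
    _ = _ := by
        rw [errorTerm]
        congr 1
        ring

end Code

/-! ### The law of the columns -/

section Law

variable {F : Type*} [Fintype F] [MeasurableSpace F]
  [MeasurableSingletonClass F] {Ω : Type*} [MeasurableSpace Ω] {μ : Measure Ω}
  [IsProbabilityMeasure μ] {k n : ℕ} {G : Ω → Matrix (Fin k) (Fin n) F}

/-- The columns of a random matrix. -/
def columns (G : Ω → Matrix (Fin k) (Fin n) F) (ω : Ω) (j : Fin n) (i : Fin k) : F := G ω i j

/-- The distribution of the column `j`. -/
noncomputable def columnLaw (μ : Measure Ω) (G : Ω → Matrix (Fin k) (Fin n) F) (j : Fin n)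
    (c : Fin k → F) : ℝ := μ.real {ω | columns G ω j = c}

omit [Fintype F] [MeasurableSingletonClass F] in
lemma measurable_columns (hG : ∀ i j, Measurable fun ω => G ω i j) : Measurable (columns G) :=
  measurable_pi_lambda _ fun j => measurable_pi_lambda _ fun i => hG i j

lemma sum_columnLaw (hG : ∀ i j, Measurable fun ω => G ω i j) (j : Fin n) :
    ∑ c, columnLaw μ G j c = 1 := by
  classical
  have hm : Measurable fun ω => columns G ω j := (measurable_pi_apply j).comp
    (measurable_columns hG)
  have h := sum_measureReal_preimage_singleton (μ := μ) (Finset.univ : Finset (Fin k → F))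
    (f := fun ω => columns G ω j) (fun c _ => hm (measurableSet_singleton c))
  simpa [columnLaw, Set.preimage] using h

omit [Fintype F] [IsProbabilityMeasure μ] in
lemma prodWeight_columnLaw [Finite F]
    (hind : IndependentSymbols μ G) (g : Fin n → Fin k → F) :
    prodWeight (columnLaw μ G) g = μ.real {ω | columns G ω = g} := by
  have h := hind.measure_inter_preimage_eq_mul Finset.univ
    (sets := fun j => {g j}) (fun j _ => measurableSet_singleton _)
  have e : {ω | columns G ω = g} =
      ⋂ j ∈ Finset.univ, (fun ω => fun i : Fin k => G ω i j) ⁻¹' {g j} := by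
    ext ω
    simp [funext_iff, columns]
  rw [Measure.real, e, h, ENNReal.toReal_prod]
  rfl

lemma integral_eq_prodExpect (hG : ∀ i j, Measurable fun ω => G ω i j)
    (hind : IndependentSymbols μ G) (X : (Fin n → Fin k → F) → ℝ) :
    ∫ ω, X (columns G ω) ∂μ = prodExpect (columnLaw μ G) X := by
  have hm := measurable_columns hG
  have : IsProbabilityMeasure (μ.map (columns G)) := Measure.isProbabilityMeasure_map hm.aemeasurable
  rw [← integral_map hm.aemeasurable (f := X) (Measurable.of_discrete.aestronglyMeasurable),
    integral_fintype (Integrable.of_finite)]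
  refine Finset.sum_congr rfl fun g _ => ?_
  rw [prodWeight_columnLaw hind, map_measureReal_apply hm (measurableSet_singleton g)]
  rfl

-- Transfers the almost sure bound on the code size to every matrix of positive weight.
omit [IsProbabilityMeasure μ] in
lemma exists_of_prodWeight_ne_zero (hind : IndependentSymbols μ G) {P : Ω → Prop} (hP : ∀ᵐ ω ∂μ, P ω)
    {g : Fin n → Fin k → F} (hg : prodWeight (columnLaw μ G) g ≠ 0) :
    ∃ ω, columns G ω = g ∧ P ω := by
  by_contra! h
  apply hg
  have h0 : μ {ω | columns G ω = g} = 0 := measure_mono_null (fun ω hω => h ω hω) (ae_iff.1 hP)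
  rw [prodWeight_columnLaw hind, Measure.real, h0]
  rfl

lemma errorTerm_nonneg {C₀ : ℝ} (hC : 0 ≤ C₀) (L N : ℕ) : 0 ≤ errorTerm C₀ L N := by
  have h : ∀ a : ℕ, 0 ≤ Real.logb 2 a := fun a =>
    div_nonneg (Real.log_natCast_nonneg a) (Real.log_nonneg (by norm_num))
  have := h L
  have := h N
  unfold errorTerm
  positivity

end Law

end RandomLinearCode

open RandomLinearCode in
theorem theorem4p2 :
    ∃ C₀ : ℝ, 0 < C₀ ∧
      ∀ {F : Type*} [Field F] [Fintype F] [DecidableEq F]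
        [MeasurableSpace F] [MeasurableSingletonClass F]
        {Ω : Type*} [MeasurableSpace Ω] (μ : Measure Ω) [IsProbabilityMeasure μ]
        (k n L N : ℕ) (G : Ω → Matrix (Fin k) (Fin n) F),
        (∀ i j, Measurable fun ω => G ω i j) →
        RandomLinearCode.IndependentSymbols μ G →
        (∀ᵐ ω ∂μ, (RandomLinearCode.code (G ω)).ncard ≤ N) →
        1 ≤ L → L ≤ Fintype.card F ^ k →
        RandomLinearCode.expMaxAgr μ G L ≤
          RandomLinearCode.maxExpAgr μ G L + RandomLinearCode.errorTerm C₀ L N +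
            Real.sqrt (RandomLinearCode.maxExpAgr μ G L *
              RandomLinearCode.errorTerm C₀ L N) := by
  refine ⟨663552, by norm_num, ?_⟩
  intro F _ _ _ _ _ Ω _ μ _ k n L N G hG hind hN hL hLk
  obtain ⟨Λ₀, -, hΛ₀⟩ := Finset.exists_subset_card_eq
    (s := (Finset.univ : Finset (Fin k → F))) (n := L) (by simpa using hLk)
  have hne : Nonempty {Λ : Finset (Fin k → F) // Λ.card = L} := ⟨⟨Λ₀, hΛ₀⟩⟩
  have hp : ∀ j c, 0 ≤ columnLaw μ G j c := fun _ _ => measureReal_nonneg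
  have hp1 := sum_columnLaw (μ := μ) hG
  let f : {Λ : Finset (Fin k → F) // Λ.card = L} → Fin n → (Fin k → F) → ℝ :=
    fun Λ _ c => colPlur Λ.1 c
  have h1 : expMaxAgr μ G L =
      prodExpect (columnLaw μ G) fun g => ⨆ Λ, ∑ j, f Λ j (g j) := by
    rw [← integral_eq_prodExpect hG hind, expMaxAgr]
    simp only [iSup_iSup_totalAgr]
    rfl
  have h2 : maxExpAgr μ G L =
      ⨆ Λ, prodExpect (columnLaw μ G) fun g => ∑ j, f Λ j (g j) := by
    simp only [maxExpAgr, ← integral_eq_prodExpect hG hind, iSup_totalAgr]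
    rfl
  have hY : 0 ≤ errorTerm 663552 L N := errorTerm_nonneg (by norm_num) L N
  rw [h1, h2]
  by_cases hcase : 2 ≤ L ∧ 2 ≤ N
  · refine prodExpect_iSup_le_of_expect_signedSup_le hp hp1 f
      (fun _ _ _ => colPlur_nonneg _ _) hY fun g hg => ?_
    obtain ⟨ω, rfl, hω⟩ := exists_of_prodWeight_ne_zero hind hN hg
    exact expect_signedSup_colPlur_le (G ω) hcase.1 hcase.2 hω
  -- If `L = 1` or `N ≤ 1`, all messages of `Λ₀` have the same encoding almost surely. Then `Λ₀`
  -- attains the largest possible plurality `L` in every column, and no error term is needed.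
  · have hdeg : ∀ g, prodWeight (columnLaw μ G) g ≠ 0 →
        ⨆ Λ, ∑ j, f Λ j (g j) ≤ ∑ j, f ⟨Λ₀, hΛ₀⟩ j (g j) := by
      intro g hg
      obtain ⟨ω, rfl, hω⟩ := exists_of_prodWeight_ne_zero hind hN hg
      obtain ⟨x₀, hx₀⟩ : Λ₀.Nonempty := Finset.card_pos.1 (by omega)
      have hconst : ∀ x ∈ Λ₀, encode (G ω) x = encode (G ω) x₀ := by
        intro x hx
        by_cases hL2 : 2 ≤ L
        · exact (Set.ncard_le_one (Set.toFinite _)).1 (hω.trans (by omega)) _ ⟨x, rfl⟩ _ ⟨x₀, rfl⟩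
        · rw [Finset.card_le_one.1 (by omega) x hx x₀ hx₀]
      refine ciSup_le fun Λ => Finset.sum_le_sum fun j _ => ?_
      refine (colPlur_le_card _ _).trans ?_
      rw [Λ.2.trans hΛ₀.symm]
      exact card_le_colPlur Λ₀ _ (encode (G ω) x₀ j) fun x hx => congrFun (hconst x hx) j
    have hle := (prodExpect_mono_of_support hp hdeg).trans
      (le_ciSup (f := fun Λ => prodExpect (columnLaw μ G) fun g => ∑ j, f Λ j (g j))
        (Set.finite_range _).bddAbove ⟨Λ₀, hΛ₀⟩)
    linarith [Real.sqrt_nonneg ((⨆ Λ, prodExpect (columnLaw μ G) fun g =>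
      ∑ j, f Λ j (g j)) * errorTerm 663552 L N)]
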